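/- Let $M$ be a smooth manifold and let $E, A, B$ be smooth real vector bundles of finite rank over $M$. Let $\mathfrak{D}E$ be the bundle of covariant differential operators of $E$, whose sections are the $\mathbb{R}$-linear maps $\mathfrak{d}:\Gamma(E)\to\Gamma(E)$ with $\mathfrak{d}(fu)=f\,\mathfrak{d}u+\mathbb{j}(\mathfrak{d})(f)\,u$ for a vector field $\mathbb{j}(\mathfrak{d})$; this defines $\mathbb{j}:\mathfrak{D}E\to TM$. Let $\mathfrak{J}E=\{\nu\in\mathrm{Hom}(\mathfrak{D}E,E):\nu(\Phi)=\Phi(\nu(1))\ \text{for } \Phi\in\mathfrak{gl}(E)\}$ be the jet bundle, with $\mathbb{d}:\Gamma(E)\to\Gamma(\mathfrak{J}E)$, $(\mathbb{d}u)(\mathfrak{d})=\mathfrak{d}u$. Suppose that $(A,B)$ is an $E$-dual pair of Lie algebroids: there is a smooth bilinear pairing $\langle\cdot,\cdot\rangle_E:A\times_M B\to E$, nondegenerate on both sides (so $B\subset\mathrm{Hom}(A,E)$ and $A\subset \mathrm{Hom}(B,E)$); $A$ and $B$ are Lie algebroids; and $\rho_A:A\to\mathfrak{D}E$, $\rho_B:B\to\mathfrak{D}E$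 are Lie algebroid representations on $E$ which are, respectively, $B$-invariant and $A$-invariant. Here $\rho_A$ is $B$-invariant if the spaces $\Gamma(\mathrm{Hom}(\wedge^kA,E)_B)$ form a subcomplex of $(\Gamma(\mathrm{Hom}(\wedge^\bullet A,E)),d^A)$, where $d^A$ is the coboundary operator of $\rho_A$, $\mathrm{Hom}(\wedge^0A,E)_B=E$, and for $k\ge1$ $\mathrm{Hom}(\wedge^kA,E)_B$ consists of all $\mu$ with $\mu(X_1,\dots,X_{k-1},\cdot)\in B$ for all $X_i$; and symmetrically for $\rho_B$ and $d^B$. In particular $d^Au\in\Gamma(B)$ and $d^Bu\in\Gamma(A)$ for $u\in\Gamma(E)$, and $\rho_A^\star(\nu)=\nu\circ\rho_A$ defines $\rho_A^\star:\mathfrak{J}E\to B$. For $X\in\Gamma(A)$ let $\mathfrak{L}_X$ act on $\Gamma(B)$ by $\langle Y,\mathfrak{L}_X\xi\rangle_E=\rho_A(X)\langle Y,\xi\rangle_E-\langle[X,Y],\xi\rangle_E$ and on $\Gamma(\mathrm{Hom}(\wedge^kB,E)_A)$, $k\ge 1$, by $(\mathfrak{L}_X\Xi)(\xi_1,\dots,\xi_k)=\rho_A(X)(\Xi(\xi_1,\dots,\xi_k))-\sum_i\Xi(\xi_1,\dots,\mathfrak{L}_X\xi_i,\dots,\xi_k)$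 (so $\mathfrak{L}_XY=[X,Y]$ for $Y\in\Gamma(A)$); for $\xi\in\Gamma(B)$ define $\mathfrak{L}_\xi$ on $\Gamma(A)$ symmetrically. Assume that $(A,B)$ is an $E$-Lie bialgebroid, i.e. for all $X,Y\in\Gamma(A)$ and $u\in\Gamma(E)$: 1. $d^B[X,Y]=\mathfrak{L}_X(d^BY)-\mathfrak{L}_Y(d^BX)$; 2. $\mathfrak{L}_{d^Au}X=-\mathfrak{L}_{d^Bu}X$; 3. $\langle d^Bu,d^Au\rangle_E=0$. Define $[u,v]_E=\langle d^Au,d^Bv\rangle_E$ for $u,v\in\Gamma(E)$. (1) If $\mathrm{rank}\,E\ge2$, then $u\mapsto\mathbb{j}\circ\rho_B\circ\rho_A^\star\circ\mathbb{d}\,u$ is induced by a smooth bundle map $E\to TM$, and $E$ with the bracket $[\cdot,\cdot]_E$ and this anchor is a Lie algebroid. (2) If $\mathrm{rank}\,E=1$, then $(E,[\cdot,\cdot]_E)$ is a local Lie algebra: $[\cdot,\cdot]_E$ is an $\mathbb{R}$-Lie algebra bracket on $\Gamma(E)$ with $\mathrm{supp}\,[u,v]_E\subset\mathrm{supp}\,u\cap\mathrm{supp}\,v$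 for all $u,v\in\Gamma(E)$. -/

import Mathlib

open Bundle
open scoped Manifold ContDiff

namespace ELie

noncomputable section

section Basic

variable {EM : Type*} [NormedAddCommGroup EM] [NormedSpace ℝ EM]
  {H : Type*} [TopologicalSpace H] (I : ModelWithCorners ℝ EM H)
  {M : Type*} [TopologicalSpace M] [ChartedSpace H M]

/-- The directional derivative `v(f) = df_x(v)` of a function `f` along a tangent vector `v`. -/
def dirDeriv (f : M → ℝ) (x : M) (v : TangentSpace I x) : ℝ :=
  mfderiv I 𝓘(ℝ, ℝ) f x v

variable (F : Type*) [NormedAddCommGroup F] [NormedSpace ℝ F]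
  (V : M → Type*) [TopologicalSpace (TotalSpace F V)]
  [∀ x, AddCommGroup (V x)] [∀ x, Module ℝ (V x)] [∀ x, TopologicalSpace (V x)]
  [FiberBundle F V] [VectorBundle ℝ F V]
  (F' : Type*) [NormedAddCommGroup F'] [NormedSpace ℝ F']
  (V' : M → Type*) [TopologicalSpace (TotalSpace F' V')]
  [∀ x, AddCommGroup (V' x)] [∀ x, Module ℝ (V' x)] [∀ x, TopologicalSpace (V' x)]
  [FiberBundle F' V'] [VectorBundle ℝ F' V']

/-- The space `Γ(V)` of smooth global sections. -/
abbrev Sec := Cₛ^∞⟮I; F, V⟯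

variable {I F V} in
/-- The product of a smooth function and a smooth section. -/
def mulSec (f : C^∞⟮I, M; 𝓘(ℝ, ℝ), ℝ⟯) (s : Sec I F V) : Sec I F V :=
  ⟨fun x => f x • s x, ContMDiff.smul_section f.contMDiff s.contMDiff⟩

variable {I F V} in
theorem exists_sec_eq [FiniteDimensional ℝ EM] [T2Space M] [IsManifold I ∞ M]
    [ContMDiffVectorBundle ∞ F V I] {x : M} (a : V x) : ∃ s : Sec I F V, s x = a := by
  obtain ⟨t, ht, hs⟩ := FiberBundle.exists_contMDiffOn_extend (k := ∞) I F a
  obtain ⟨o, hot, ho, hxo⟩ := mem_nhds_iff.mp ht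
  obtain ⟨f, hf⟩ := (SmoothBumpFunction.nhds_basis_support (I := I)
    (ho.mem_nhds hxo)).ex_mem
  refine ⟨⟨_, ContMDiffOn.smul_section_of_tsupport (ψ := f) f.contMDiff.contMDiffOn ho hf
    (hs.mono hot)⟩, ?_⟩
  simp [f.eq_one]

/-- Smooth vector bundle maps `V → V'` over the identity of `M`. -/
structure BundleMap where
  toFun : ∀ x, V x →ₗ[ℝ] V' x
  contMDiff_toFun : ContMDiff (I.prod 𝓘(ℝ, F)) (I.prod 𝓘(ℝ, F')) ∞
    (fun p : TotalSpace F V => (⟨p.1, toFun p.1 p.2⟩ : TotalSpace F' V'))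

/-- Lie algebroid structures on the vector bundle `V`: a real Lie bracket on `Γ(V)` and a bundle map
`V → TM`, the anchor, which satisfy the Leibniz rule; the anchor is a bracket homomorphism, the
bracket of vector fields being the commutator of derivations. -/
structure LieAlgebroid [IsManifold I ∞ M] where
  bracket : Sec I F V →ₗ[ℝ] Sec I F V →ₗ[ℝ] Sec I F V
  bracket_self : ∀ X, bracket X X = 0
  jacobi : ∀ X Y Z, bracket X (bracket Y Z) = bracket (bracket X Y) Z + bracket Y (bracket X Z)
  anchor : BundleMap I F V EM (TangentSpace I : M → Type _)
  leibniz : ∀ (X Y : Sec I F V) (f : C^∞⟮I, M; 𝓘(ℝ, ℝ), ℝ⟯) (x : M),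
    bracket X (mulSec f Y) x = f x • bracket X Y x + dirDeriv I f x (anchor.toFun x (X x)) • Y x
  anchor_bracket : ∀ (X Y : Sec I F V) (f : C^∞⟮I, M; 𝓘(ℝ, ℝ), ℝ⟯) (x : M),
    dirDeriv I f x (anchor.toFun x (bracket X Y x)) =
      dirDeriv I (fun y => dirDeriv I f y (anchor.toFun y (Y y))) x (anchor.toFun x (X x)) -
      dirDeriv I (fun y => dirDeriv I f y (anchor.toFun y (X y))) x (anchor.toFun x (Y x))

/-- Local Lie algebra structures on the vector bundle `V`: a real Lie bracket on `Γ(V)` such that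
`supp [u, v] ⊆ supp u ∩ supp v`. -/
structure LocalLieAlgebra where
  bracket : Sec I F V →ₗ[ℝ] Sec I F V →ₗ[ℝ] Sec I F V
  bracket_self : ∀ u, bracket u u = 0
  jacobi : ∀ u v w, bracket u (bracket v w) = bracket (bracket u v) w + bracket v (bracket u w)
  support_subset : ∀ u v,
    closure {x | bracket u v x ≠ 0} ⊆ closure {x | u x ≠ 0} ∩ closure {x | v x ≠ 0}

/-- The fibre at `x` of the bundle `𝔇V` of covariant differential operators: the pairs of an
`ℝ`-linear map `δ : Γ(V) → V x` and a tangent vector `v` at `x`, the symbol of `δ`, with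
`δ(f u) = f(x) δ(u) + v(f) u(x)`. (If the rank of `V` is positive, then `δ` determines `v`.) -/
def gaugeFiber (x : M) : Submodule ℝ ((Sec I F V →ₗ[ℝ] V x) × TangentSpace I x) where
  carrier := {δ | ∀ (f : C^∞⟮I, M; 𝓘(ℝ, ℝ), ℝ⟯) (u : Sec I F V),
    δ.1 (mulSec f u) = f x • δ.1 u + dirDeriv I f x δ.2 • u x}
  add_mem' := by
    intro a b ha hb f u
    have h : dirDeriv I f x (a.2 + b.2) = dirDeriv I f x a.2 + dirDeriv I f x b.2 :=
      map_add (mfderiv I 𝓘(ℝ, ℝ) f x) a.2 b.2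
    simp only [Prod.fst_add, Prod.snd_add, LinearMap.add_apply, ha f u, hb f u, h, smul_add,
      add_smul]
    abel
  zero_mem' := by
    intro f u
    have h : dirDeriv I f x 0 = 0 := map_zero (mfderiv I 𝓘(ℝ, ℝ) f x)
    simp [h]
  smul_mem' := by
    intro c a ha f u
    have h : dirDeriv I f x (c • a.2) = c * dirDeriv I f x a.2 :=
      map_smul (mfderiv I 𝓘(ℝ, ℝ) f x) c a.2
    simp only [Prod.smul_fst, Prod.smul_snd, LinearMap.smul_apply, ha f u, h, smul_add, mul_smul,
      smul_comm c (f x)]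

/-- The projection `𝕛 : 𝔇V → TM` of the Atiyah sequence. -/
def symbol (x : M) : gaugeFiber I F V x →ₗ[ℝ] TangentSpace I x :=
  LinearMap.snd ℝ _ _ ∘ₗ (gaugeFiber I F V x).subtype

variable {I F V} in
/-- The action of an element of the fibre of `𝔇V` on a section of `V`. -/
def gaugeApply {x : M} (u : Sec I F V) : gaugeFiber I F V x →ₗ[ℝ] V x :=
  LinearMap.applyₗ u ∘ₗ LinearMap.fst ℝ _ _ ∘ₗ (gaugeFiber I F V x).subtype

variable {V} in
/-- The inclusion `𝔤𝔩(V) → 𝔇V` of the Atiyah sequence. -/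
def ofEnd (x : M) (Φ : V x →ₗ[ℝ] V x) : gaugeFiber I F V x :=
  ⟨(Φ ∘ₗ { toFun := fun u => u x, map_add' := fun _ _ => rfl, map_smul' := fun _ _ => rfl }, 0), by
    intro f u
    have h : dirDeriv I f x 0 = 0 := map_zero (mfderiv I 𝓘(ℝ, ℝ) f x)
    simp [h, mulSec]⟩

/-- The fibre at `x` of the jet bundle `𝔍V`, as the subspace of all `ν` in `Hom(𝔇V, V)` with
`ν(Φ) = Φ(ν(1))` for all endomorphisms `Φ` of the fibre of `V`. -/
def jetFiber (x : M) : Submodule ℝ (gaugeFiber I F V x →ₗ[ℝ] V x) where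
  carrier := {ν | ∀ Φ : V x →ₗ[ℝ] V x, ν (ofEnd I F x Φ) = Φ (ν (ofEnd I F x LinearMap.id))}
  add_mem' := by
    intro a b ha hb Φ
    simp only [LinearMap.add_apply, ha Φ, hb Φ, map_add]
  zero_mem' := by
    intro Φ
    simp
  smul_mem' := by
    intro c a ha Φ
    simp only [LinearMap.smul_apply, ha Φ, map_smul]

variable {I F V} in
/-- The value at `x` of the jet `𝕕 u`, that is, `(𝕕 u)(δ) = δ(u)`. -/
def jet (u : Sec I F V) (x : M) : jetFiber I F V x :=
  ⟨gaugeApply u, fun _ => rfl⟩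

variable {I F V} in
/-- The `V`-adjoint `φ^⋆ : Hom(𝔇V, V) → Hom(K, V)` of `φ : K → 𝔇V` in one fibre. -/
def adjoint {x : M} {K : Type*} [AddCommGroup K] [Module ℝ K] (φ : K →ₗ[ℝ] gaugeFiber I F V x) :
    (gaugeFiber I F V x →ₗ[ℝ] V x) →ₗ[ℝ] (K →ₗ[ℝ] V x) :=
  LinearMap.lcomp ℝ (V x) φ

end Basic

section Dual

variable {EM : Type*} [NormedAddCommGroup EM] [NormedSpace ℝ EM]
  {H : Type*} [TopologicalSpace H] {I : ModelWithCorners ℝ EM H}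
  {M : Type*} [TopologicalSpace M] [ChartedSpace H M] [IsManifold I ∞ M]
  {FA : Type*} [NormedAddCommGroup FA] [NormedSpace ℝ FA]
  {A : M → Type*} [TopologicalSpace (TotalSpace FA A)]
  [∀ x, AddCommGroup (A x)] [∀ x, Module ℝ (A x)] [∀ x, TopologicalSpace (A x)]
  [FiberBundle FA A] [VectorBundle ℝ FA A]
  {FB : Type*} [NormedAddCommGroup FB] [NormedSpace ℝ FB]
  {B : M → Type*} [TopologicalSpace (TotalSpace FB B)]
  [∀ x, AddCommGroup (B x)] [∀ x, Module ℝ (B x)] [∀ x, TopologicalSpace (B x)]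
  [FiberBundle FB B] [VectorBundle ℝ FB B]
  {FE : Type*} [NormedAddCommGroup FE] [NormedSpace ℝ FE]
  {E : M → Type*} [TopologicalSpace (TotalSpace FE E)]
  [∀ x, AddCommGroup (E x)] [∀ x, Module ℝ (E x)] [∀ x, TopologicalSpace (E x)]
  [FiberBundle FE E] [VectorBundle ℝ FE E]

variable (FE E) in
/-- Representations of the Lie algebroid `A` on `E`: bundle maps `ρ : A → 𝔇E` over the identity of
`M` that are morphisms of Lie algebroids. The map is smooth in the sense that `ρ(X)` is a smooth
section of `𝔇E`, i.e. maps smooth sections of `E` to smooth sections, for all `X` in `Γ(A)`. -/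
structure Representation (L : LieAlgebroid I FA A) where
  toFun : ∀ x, A x →ₗ[ℝ] gaugeFiber I FE E x
  contMDiff_toFun : ∀ (X : Sec I FA A) (u : Sec I FE E), ContMDiff I (I.prod 𝓘(ℝ, FE)) ∞
    (fun x => (⟨x, gaugeApply u (toFun x (X x))⟩ : TotalSpace FE E))
  symbol_toFun : ∀ x a, symbol I FE E x (toFun x a) = L.anchor.toFun x a
  toFun_bracket : ∀ (X Y : Sec I FA A) (u : Sec I FE E) (x : M),
    gaugeApply u (toFun x (L.bracket X Y x)) =
      gaugeApply (⟨_, contMDiff_toFun Y u⟩ : Sec I FE E) (toFun x (X x)) -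
      gaugeApply (⟨_, contMDiff_toFun X u⟩ : Sec I FE E) (toFun x (Y x))

/-- The section `ρ(X) u` of `E`. -/
def Representation.act {L : LieAlgebroid I FA A} (ρ : Representation FE E L) (X : Sec I FA A)
    (u : Sec I FE E) : Sec I FE E :=
  ⟨fun x => gaugeApply u (ρ.toFun x (X x)), ρ.contMDiff_toFun X u⟩

variable (I FA A FB B FE E) in
/-- `A` and `B` as mutually `E`-dual vector bundles: a smooth fibrewise bilinear pairing
`A ×_M B → E` that is nondegenerate on both sides. In other words, `b ↦ ⟨·, b⟩` identifies `B` with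
a subbundle of `Hom(A, E)` whose evaluation pairing with `A` is nondegenerate. -/
structure EPairing where
  toFun : ∀ x, A x →ₗ[ℝ] B x →ₗ[ℝ] E x
  contMDiff_toFun : ∀ (X : Sec I FA A) (ξ : Sec I FB B), ContMDiff I (I.prod 𝓘(ℝ, FE)) ∞
    (fun x => (⟨x, toFun x (X x) (ξ x)⟩ : TotalSpace FE E))
  nondeg_left : ∀ x (a : A x), (∀ b, toFun x a b = 0) → a = 0
  nondeg_right : ∀ x (b : B x), (∀ a, toFun x a b = 0) → b = 0

namespace EPairing

/-- The same pairing with the roles of `A` and `B` exchanged. -/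
def flip (P : EPairing I FA A FB B FE E) : EPairing I FB B FA A FE E where
  toFun x := (P.toFun x).flip
  contMDiff_toFun ξ X := P.contMDiff_toFun X ξ
  nondeg_left := P.nondeg_right
  nondeg_right := P.nondeg_left

/-- The pairing `⟨X, ξ⟩` of sections. -/
def pair (P : EPairing I FA A FB B FE E) (X : Sec I FA A) (ξ : Sec I FB B) : Sec I FE E :=
  ⟨fun x => P.toFun x (X x) (ξ x), P.contMDiff_toFun X ξ⟩

open Classical in
/-- The inverse of the embedding `B → Hom(A, E)` on its image (and `0` off the image). -/
def ofHom (P : EPairing I FA A FB B FE E) (x : M) (φ : A x →ₗ[ℝ] E x) : B x :=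
  if h : ∃ b, ∀ a, P.toFun x a b = φ a then h.choose else 0

end EPairing

variable (I FA A FE E) in
/-- `E`-valued `k`-forms on `A`, i.e. the elements of `Γ(Hom(∧ᵏA, E))`. -/
structure Form (k : ℕ) where
  toFun : ∀ x, A x [⋀^Fin k]→ₗ[ℝ] E x
  contMDiff_toFun : ∀ X : Fin k → Sec I FA A, ContMDiff I (I.prod 𝓘(ℝ, FE)) ∞
    (fun x => (⟨x, toFun x (fun i => X i x)⟩ : TotalSpace FE E))

/-- The section `θ(X₁, …, X_k)` of `E`. -/
def Form.eval {k : ℕ} (θ : Form I FA A FE E k) (X : Fin k → Sec I FA A) : Sec I FE E :=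
  ⟨fun x => θ.toFun x (fun i => X i x), θ.contMDiff_toFun X⟩

/-- A section of `E` as a `0`-form on `A`. -/
def zeroForm (u : Sec I FE E) : Form I FA A FE E 0 where
  toFun x := AlternatingMap.constOfIsEmpty ℝ (A x) (Fin 0) (u x)
  contMDiff_toFun _ := u.contMDiff

/-- A section of `B` as a `1`-form on `A`. -/
def EPairing.oneForm (P : EPairing I FA A FB B FE E) (ξ : Sec I FB B) : Form I FA A FE E 1 where
  toFun x := AlternatingMap.ofSubsingleton ℝ (A x) (E x) (0 : Fin 1) ((P.toFun x).flip (ξ x))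
  contMDiff_toFun X := P.contMDiff_toFun (X 0) ξ

/-- The coboundary operator `d^A` of a representation, with values on sections,
`(dθ)(X₀, …, X_k) = ∑ᵢ (-1)ⁱ ρ(Xᵢ) θ(…, X̂ᵢ, …)
  + ∑_{i<j} (-1)^{i+j} θ([Xᵢ, Xⱼ], …, X̂ᵢ, …, X̂ⱼ, …)`.
In the second sum the entry `[Xᵢ, Xⱼ]` is moved to the place of `Xⱼ`, which turns the sign into
`-(-1)ⁱ`. -/
def Representation.coboundary {L : LieAlgebroid I FA A} (ρ : Representation FE E L) {k : ℕ}
    (θ : Form I FA A FE E k) (X : Fin (k + 1) → Sec I FA A) : Sec I FE E :=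
  ∑ i : Fin (k + 1), (-1 : ℝ) ^ (i : ℕ) •
    (ρ.act (X i) (θ.eval (i.removeNth X)) -
      ∑ j ∈ Finset.Ioi i, θ.eval (i.removeNth (Function.update X j (L.bracket (X i) (X j)))))

/-- The condition that a `k`-form on `A`, given by its values on sections, lies in
`Γ(Hom(∧ᵏA, E)_B)`: there is no condition if `k = 0`, and `T(X₁, …, X_{k-1}, ·)` has to be a section
of `B` if `k ≥ 1`. -/
def EPairing.InDual (P : EPairing I FA A FB B FE E) :
    (k : ℕ) → ((Fin k → Sec I FA A) → Sec I FE E) → Prop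
  | 0, _ => True
  | k + 1, T => ∀ X : Fin k → Sec I FA A, ∃ ξ : Sec I FB B, ∀ Y : Sec I FA A,
      T (Fin.snoc (α := fun _ => Sec I FA A) X Y) = P.pair Y ξ

/-- `B`-invariant representations of `A`: the spaces `Γ(Hom(∧ᵏA, E)_B)` form a subcomplex of
the complex of `E`-valued forms on `A`. -/
def Representation.IsInvariant {L : LieAlgebroid I FA A} (ρ : Representation FE E L)
    (P : EPairing I FA A FB B FE E) : Prop :=
  ∀ (k : ℕ) (θ : Form I FA A FE E k), P.InDual k θ.eval → P.InDual (k + 1) (ρ.coboundary θ)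

section Invariant

variable {L : LieAlgebroid I FA A} {ρ : Representation FE E L} {P : EPairing I FA A FB B FE E}

theorem exists_d (h : ρ.IsInvariant P) (u : Sec I FE E) :
    ∃ ξ : Sec I FB B, ∀ X, P.pair X ξ = ρ.act X u := by
  obtain ⟨ξ, hξ⟩ := h 0 (zeroForm u) trivial Fin.elim0
  refine ⟨ξ, fun X => ?_⟩
  rw [← hξ X]
  ext x
  simp [Representation.coboundary, Fin.snoc, Representation.act, Form.eval, zeroForm]
  rfl

/-- `d^A u` for `u` in `Γ(E)`, as a section of `B`: `⟨X, d^A u⟩ = ρ(X) u`. -/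
def d (h : ρ.IsInvariant P) (u : Sec I FE E) : Sec I FB B := (exists_d h u).choose

theorem pair_d (h : ρ.IsInvariant P) (u : Sec I FE E) (X : Sec I FA A) :
    P.pair X (d h u) = ρ.act X u := (exists_d h u).choose_spec X

theorem coboundary_oneForm (ξ : Sec I FB B) (X Y : Sec I FA A) :
    ρ.coboundary (P.oneForm ξ) ![X, Y] =
      ρ.act X (P.pair Y ξ) - P.pair (L.bracket X Y) ξ - ρ.act Y (P.pair X ξ) := by
  have h0 : Finset.Ioi (0 : Fin 2) = {1} := by decide
  have h1 : Finset.Ioi (1 : Fin 2) = ∅ := by decide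
  refine (Fin.sum_univ_two _).trans ?_
  rw [h0, h1, Finset.sum_singleton, Finset.sum_empty, sub_zero]
  simp only [Fin.val_zero, Fin.val_one, pow_zero, pow_one, one_smul, neg_smul, ← sub_eq_add_neg]
  rfl

theorem exists_lieDeriv (h : ρ.IsInvariant P) (X : Sec I FA A) (ξ : Sec I FB B) :
    ∃ ζ : Sec I FB B, ∀ Y, P.pair Y ζ = ρ.act X (P.pair Y ξ) - P.pair (L.bracket X Y) ξ := by
  obtain ⟨ζ, hζ⟩ := h 1 (P.oneForm ξ) (fun _ => ⟨ξ, fun Y => rfl⟩) ![X]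
  refine ⟨ζ + d h (P.pair X ξ), fun Y => ?_⟩
  have h1 : P.pair Y (ζ + d h (P.pair X ξ)) = P.pair Y ζ + P.pair Y (d h (P.pair X ξ)) := by
    ext x
    exact map_add (P.toFun x (Y x)) _ _
  have h2 : (Fin.snoc (α := fun _ => Sec I FA A) ![X] Y) = ![X, Y] := by
    ext i : 1
    fin_cases i <;> rfl
  rw [h1, pair_d, ← hζ Y, h2, coboundary_oneForm]
  abel

/-- The Lie derivative `𝔏_X ξ` of a section of `B` along a section of `A`, as a section of `B`:
`⟨Y, 𝔏_X ξ⟩ = ρ(X) ⟨Y, ξ⟩ - ⟨[X, Y], ξ⟩`. -/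
def lieDeriv (h : ρ.IsInvariant P) (X : Sec I FA A) (ξ : Sec I FB B) : Sec I FB B :=
  (exists_lieDeriv h X ξ).choose

theorem pair_lieDeriv (h : ρ.IsInvariant P) (X Y : Sec I FA A) (ξ : Sec I FB B) :
    P.pair Y (lieDeriv h X ξ) = ρ.act X (P.pair Y ξ) - P.pair (L.bracket X Y) ξ :=
  (exists_lieDeriv h X ξ).choose_spec Y

/-- The Lie derivative along a section `X` of `A` of a `k`-form `T` on `B`:
`(𝔏_X T)(ξ₁, …, ξ_k) = ρ(X)(T(ξ₁, …, ξ_k)) - ∑ᵢ T(ξ₁, …, 𝔏_X ξᵢ, …, ξ_k)`. -/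
def lieDerivForm (h : ρ.IsInvariant P) (X : Sec I FA A) {k : ℕ}
    (T : (Fin k → Sec I FB B) → Sec I FE E) (ξ : Fin k → Sec I FB B) : Sec I FE E :=
  ρ.act X (T ξ) - ∑ i, T (Function.update ξ i (lieDeriv h X (ξ i)))

/-- `ρ^⋆ : 𝔍E → B` at `x`: the `E`-adjoint map of `ρ` with values regarded as elements of `B`. -/
def jetAdjoint (ρ : Representation FE E L) (P : EPairing I FA A FB B FE E) (x : M)
    (ν : jetFiber I FE E x) : B x :=
  P.ofHom x (adjoint (ρ.toFun x) ν)

/-- `ρ^⋆ (𝕕 u)` is the value of `d^A u`. In particular, it is really represented by an element of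
`B`. -/
theorem jetAdjoint_jet [FiniteDimensional ℝ EM] [T2Space M] [ContMDiffVectorBundle ∞ FA A I]
    (h : ρ.IsInvariant P) (u : Sec I FE E) (x : M) :
    jetAdjoint ρ P x (jet u x) = d h u x := by
  have key : ∀ a, P.toFun x a (d h u x) = adjoint (ρ.toFun x) (jet u x : _ →ₗ[ℝ] E x) a := by
    intro a
    obtain ⟨X, rfl⟩ := exists_sec_eq (I := I) (F := FA) a
    exact congrArg (fun s : Sec I FE E => s x) (pair_d h u X)
  have hex : ∃ b, ∀ a, P.toFun x a b = adjoint (ρ.toFun x) (jet u x : _ →ₗ[ℝ] E x) a := ⟨_, key⟩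
  have hc := hex.choose_spec
  unfold jetAdjoint EPairing.ofHom
  rw [dif_pos hex]
  refine sub_eq_zero.mp (P.nondeg_right x _ fun a => ?_)
  rw [map_sub, hc, key, sub_self]

end Invariant

variable (I FA A FB B FE E) in
/-- `E`-dual pairs of Lie algebroids: mutually `E`-dual vector bundles `A` and `B`, Lie algebroid
structures on both, a `B`-invariant representation of `A` on `E` and an `A`-invariant representation
of `B` on `E`. -/
structure EDualPair where
  pairing : EPairing I FA A FB B FE E
  algA : LieAlgebroid I FA A
  algB : LieAlgebroid I FB B
  repA : Representation FE E algA
  repB : Representation FE E algB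
  invA : repA.IsInvariant pairing
  invB : repB.IsInvariant pairing.flip

variable (I FA A FB B FE E) in
/-- `E`-Lie bialgebroids. Here `d invA u` is `d^A u` in `Γ(B)`, `d invB u` is `d^B u` in `Γ(A)`, and
`repB.coboundary (pairing.flip.oneForm X)` is `d^B X` in `Γ(Hom(∧²B, E))`. -/
structure ELieBialgebroid extends EDualPair I FA A FB B FE E where
  compat_bracket : ∀ X Y : Sec I FA A,
    repB.coboundary (pairing.flip.oneForm (algA.bracket X Y)) =
      lieDerivForm invA X (repB.coboundary (pairing.flip.oneForm Y)) -
      lieDerivForm invA Y (repB.coboundary (pairing.flip.oneForm X))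
  compat_lieDeriv : ∀ (u : Sec I FE E) (X : Sec I FA A),
    lieDeriv invB (d invA u) X = -algA.bracket (d invB u) X
  compat_pair : ∀ u : Sec I FE E, pairing.pair (d invB u) (d invA u) = 0

/-- The bracket `[u, v]_E = ⟨d^A u, d^B v⟩_E` on `Γ(E)`. -/
def ELieBialgebroid.bracketE (D : ELieBialgebroid I FA A FB B FE E) (u v : Sec I FE E) :
    Sec I FE E :=
  D.pairing.pair (d D.invB v) (d D.invA u)

end Dual

end

end ELie

namespace ELie

noncomputable section

/-! ### Pointwise evaluation of sections -/

section BasicLemmas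

variable {EM : Type*} [NormedAddCommGroup EM] [NormedSpace ℝ EM]
  {H : Type*} [TopologicalSpace H] {I : ModelWithCorners ℝ EM H}
  {M : Type*} [TopologicalSpace M] [ChartedSpace H M]
  {F : Type*} [NormedAddCommGroup F] [NormedSpace ℝ F]
  {V : M → Type*} [TopologicalSpace (TotalSpace F V)]
  [∀ x, AddCommGroup (V x)] [∀ x, Module ℝ (V x)] [∀ x, TopologicalSpace (V x)]
  [FiberBundle F V] [VectorBundle ℝ F V]

/-! Everything rests on two readings of the bracket: `[u, v]_E = ρ_B(d^A u) v = ρ_A(d^B v) u`. The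
first makes it a derivation in `v` whose symbol is the vector field `a(u)`, the anchor of `B`
applied to `d^A u`; condition 3 makes it alternating.

For Jacobi, condition 2 at `X = d^B v`, together with the fact that Lie derivatives commute with
`d`, gives `d^B [u, v]_E = -[d^B u, d^B v]` (`d_bracketE`). Applying the representation `ρ_A` turns
this into the Jacobi identity. Locality follows from the Leibniz rule and a bump function, which
settles rank one.

In rank at least two, expanding `[g u, f v]_E` in both orders yields `(f a(v)(g) - a(f v)(g)) u + (g
a(u)(f) - a(g u)(f)) v = 0`. Where `u` and `v` are independent both coefficients vanish, so `a` is
`C^∞(M)`-linear (`anchorField_mulSec`) and comes from a bundle map (`exists_bundleMap`). It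
preserves brackets because Jacobi forces `d^A [u, v]_E` and `[d^A u, d^A v]` to act alike on `Γ(E)`,
hence to have the same symbol. -/

@[simp]
theorem mulSec_apply (f : C^∞⟮I, M; 𝓘(ℝ, ℝ), ℝ⟯) (s : Sec I F V) (x : M) :
    mulSec f s x = f x • s x := rfl

theorem sum_sec_apply {ι : Type*} (s : Finset ι) (u : ι → Sec I F V) (x : M) :
    (∑ i ∈ s, u i) x = ∑ i ∈ s, u i x :=
  map_sum ({ toFun := fun u => u x, map_zero' := rfl, map_add' := fun _ _ => rfl } :
    Sec I F V →+ V x) u s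

theorem dirDeriv_smul (f : M → ℝ) (x : M) (r : ℝ) (v : TangentSpace I x) :
    dirDeriv I f x (r • v) = r * dirDeriv I f x v :=
  map_smul (mfderiv I 𝓘(ℝ, ℝ) f x) r v

end BasicLemmas

/-! ### Cut-off frames, tensorial maps and separation of tangent vectors -/

section Tensorial

open Topology

variable {EM : Type*} [NormedAddCommGroup EM] [NormedSpace ℝ EM] [FiniteDimensional ℝ EM]
  {H : Type*} [TopologicalSpace H] {I : ModelWithCorners ℝ EM H}
  {M : Type*} [TopologicalSpace M] [T2Space M] [ChartedSpace H M] [IsManifold I ∞ M]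
  {F : Type*} [NormedAddCommGroup F] [NormedSpace ℝ F]
  {V : M → Type*} [TopologicalSpace (TotalSpace F V)]
  [∀ x, AddCommGroup (V x)] [∀ x, Module ℝ (V x)] [∀ x, TopologicalSpace (V x)]
  [FiberBundle F V] [VectorBundle ℝ F V]
  {F' : Type*} [NormedAddCommGroup F'] [NormedSpace ℝ F']
  {V' : M → Type*} [TopologicalSpace (TotalSpace F' V')]
  [∀ x, AddCommGroup (V' x)] [∀ x, Module ℝ (V' x)] [∀ x, TopologicalSpace (V' x)]
  [FiberBundle F' V'] [VectorBundle ℝ F' V']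

theorem exists_bump {s : Set M} {x : M} (hs : s ∈ 𝓝 x) :
    ∃ χ : C^∞⟮I, M; 𝓘(ℝ, ℝ), ℝ⟯, (∀ᶠ y in 𝓝 x, χ y = 1) ∧ tsupport χ ⊆ s := by
  obtain ⟨f, hf⟩ := (SmoothBumpFunction.nhds_basis_support (I := I) hs).ex_mem
  exact ⟨⟨f, f.contMDiff⟩, f.eventuallyEq_one, hf⟩

theorem exists_sec_ne_zero [Nontrivial F] [ContMDiffVectorBundle ∞ F V I] (x : M) :
    ∃ s : Sec I F V, s x ≠ 0 := by
  obtain ⟨a, ha⟩ := exists_ne (0 : F)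
  obtain ⟨s, hs⟩ := exists_sec_eq (I := I) (F := F)
    ((VectorBundle.continuousLinearEquivAt ℝ F V x).symm a)
  refine ⟨s, fun h => ha ?_⟩
  exact (VectorBundle.continuousLinearEquivAt ℝ F V x).symm.map_eq_zero_iff.1 (hs.symm.trans h)

/-- Around each point there are global sections which form a local frame, with globally defined
coefficient functions, up to a cut-off function. -/
theorem exists_cutoff_frame [FiniteDimensional ℝ F] [ContMDiffVectorBundle ∞ F V I] (x₀ : M) :
    ∃ (n : ℕ) (χ : C^∞⟮I, M; 𝓘(ℝ, ℝ), ℝ⟯) (e : Fin n → Sec I F V)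
      (c : Fin n → ∀ y, V y →ₗ[ℝ] ℝ),
      (∀ᶠ y in 𝓝 x₀, χ y = 1) ∧
      (∀ i, ContMDiff (I.prod 𝓘(ℝ, F)) 𝓘(ℝ, ℝ) ∞ (fun p : TotalSpace F V => c i p.1 p.2)) ∧
      ∀ y (v : V y), (χ y * χ y) • v = ∑ i, c i y v • e i y := by
  let t := trivializationAt F V x₀
  let b := Module.finBasis ℝ F
  obtain ⟨χ, hχ, hs⟩ := exists_bump (I := I)
    (t.open_baseSet.mem_nhds (FiberBundle.mem_baseSet_trivializationAt F V x₀))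
  have hz : ∀ y, y ∉ t.baseSet → χ y = 0 := fun y hy =>
    image_eq_zero_of_notMem_tsupport fun h => hy (hs h)
  -- Frame sections and coefficient functionals each need a factor `χ` to extend by zero to all of
  -- `M`; hence the square of `χ` in the expansion.
  refine ⟨_, χ, fun i => ⟨_, ContMDiffOn.smul_section_of_tsupport (ψ := χ)
      χ.contMDiff.contMDiffOn t.open_baseSet hs (t.contMDiffOn_localFrame_baseSet ∞ b i)⟩,
    fun i y => χ y • b.coord i ∘ₗ t.linearMapAt ℝ y, hχ, fun i p => ?_, fun y v => ?_⟩
  · have hχp : ContMDiff (I.prod 𝓘(ℝ, F)) 𝓘(ℝ, ℝ) ∞ (fun p : TotalSpace F V => χ p.1) :=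
      χ.contMDiff.comp (contMDiff_proj V)
    by_cases hp : p.1 ∈ t.baseSet
    · have h1 : ContMDiffAt (I.prod 𝓘(ℝ, F)) 𝓘(ℝ, F) ∞ (fun p : TotalSpace F V => (t p).2) p :=
        contMDiffAt_snd.comp p ((t.contMDiffOn).contMDiffAt
          (t.open_source.mem_nhds (t.mem_source.2 hp)))
      have h2 : ContMDiffAt (I.prod 𝓘(ℝ, F)) 𝓘(ℝ, ℝ) ∞
          (fun p : TotalSpace F V => (b.coord i).toContinuousLinearMap (t p).2) p :=
        (b.coord i).toContinuousLinearMap.contMDiff.contMDiffAt.comp p h1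
      refine (hχp.contMDiffAt.smul h2).congr_of_eventuallyEq ?_
      filter_upwards [t.open_source.mem_nhds (t.mem_source.2 hp)] with q hq
      have := t.coe_linearMapAt_of_mem (R := ℝ) (t.mem_source.1 hq)
      simp [this]
    · refine (contMDiffAt_const (c := (0 : ℝ))).congr_of_eventuallyEq ?_
      have ho : IsOpen (TotalSpace.proj ⁻¹' (tsupport χ)ᶜ : Set (TotalSpace F V)) :=
        (isClosed_tsupport χ).isOpen_compl.preimage (FiberBundle.continuous_proj F V)
      filter_upwards [ho.mem_nhds (fun h => hp (hs h))] with q hq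
      simp [image_eq_zero_of_notMem_tsupport hq]
  · by_cases hy : y ∈ t.baseSet
    · have h1 : ∑ i, b.repr (t.linearMapAt ℝ y v) i • t.localFrame b i y = v := by
        have := (t.basisAt b hy).sum_repr v
        simpa [hy, Trivialization.basisAt, ← t.coe_linearMapAt_of_mem (R := ℝ) hy] using this
      conv_lhs => rw [← h1, Finset.smul_sum]
      refine Finset.sum_congr rfl fun i _ => ?_
      simp [smul_smul]
      ring_nf
    · simp [hz y hy]

/-- `C^∞(M)`-linear maps between spaces of sections are induced by smooth bundle maps. -/
theorem exists_bundleMap [FiniteDimensional ℝ F] [ContMDiffVectorBundle ∞ F V I]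
    (Φ : Sec I F V →ₗ[ℝ] Sec I F' V') (hΦ : ∀ f u, Φ (mulSec f u) = mulSec f (Φ u)) :
    ∃ φ : BundleMap I F V F' V', ∀ u x, φ.toFun x (u x) = Φ u x := by
  have key : ∀ {n : ℕ} {χ : C^∞⟮I, M; 𝓘(ℝ, ℝ), ℝ⟯} {e : Fin n → Sec I F V}
      {c : Fin n → ∀ y, V y →ₗ[ℝ] ℝ}
      (_ : ∀ i, ContMDiff (I.prod 𝓘(ℝ, F)) 𝓘(ℝ, ℝ) ∞ (fun p : TotalSpace F V => c i p.1 p.2))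
      (_ : ∀ y (v : V y), (χ y * χ y) • v = ∑ i, c i y v • e i y) (u : Sec I F V) (y : M),
      (χ y * χ y) • Φ u y = ∑ i, c i y (u y) • Φ (e i) y := by
    intro n χ e c hc he u y
    -- The coefficients of `u` are global smooth functions, so `Φ` can be moved past them.
    let g : Fin n → C^∞⟮I, M; 𝓘(ℝ, ℝ), ℝ⟯ := fun i => ⟨_, (hc i).comp u.contMDiff⟩
    have h1 : mulSec (χ * χ) u = ∑ i, mulSec (g i) (e i) := by
      ext z
      rw [sum_sec_apply]
      exact he z (u z)
    have h2 := congrArg (fun s => Φ s y) h1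
    simp only [map_sum, hΦ, sum_sec_apply] at h2
    exact h2
  have hpt : ∀ (u w : Sec I F V) x, u x = w x → Φ u x = Φ w x := by
    intro u w x h
    obtain ⟨n, χ, e, c, hχ, hc, he⟩ := exists_cutoff_frame (I := I) (F := F) (V := V) x
    have hu := key hc he u x
    have hw := key hc he w x
    rw [hχ.self_of_nhds, one_mul, one_smul] at hu hw
    rw [hu, hw, h]
  -- The chosen sections need not depend smoothly on `v`: by `hpt` the choice is immaterial, and
  -- smoothness comes from the frame expansion below.
  choose s hs using fun (x : M) (v : V x) => exists_sec_eq (I := I) (F := F) v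
  refine ⟨⟨fun x => ⟨⟨fun v => Φ (s x v) x, fun v w => ?_⟩, fun r v => ?_⟩, fun p => ?_⟩,
    fun u x => hpt _ _ _ (hs x (u x))⟩
  · rw [← Pi.add_apply, ← ContMDiffSection.coe_add, ← map_add]
    exact hpt _ _ _ (by simp [hs])
  · change Φ _ x = r • Φ _ x
    rw [← Pi.smul_apply, ← ContMDiffSection.coe_smul, ← map_smul]
    exact hpt _ _ _ (by simp [hs])
  · obtain ⟨n, χ, e, c, hχ, hc, he⟩ := exists_cutoff_frame (I := I) (F := F) (V := V) p.1
    rw [contMDiffAt_totalSpace]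
    refine ⟨contMDiffAt_proj V, ?_⟩
    let t := trivializationAt F' V' p.1
    have hsum : ContMDiffAt (I.prod 𝓘(ℝ, F)) 𝓘(ℝ, F') ∞
        (fun q : TotalSpace F V => ∑ i, c i q.1 q.2 • (t ⟨q.1, Φ (e i) q.1⟩).2) p := by
      refine ContMDiffAt.sum fun i _ => (hc i).contMDiffAt.smul ?_
      have := (contMDiffAt_section p.1).1 ((Φ (e i)).contMDiff p.1)
      exact ContMDiffAt.comp (g := fun y => (t ⟨y, Φ (e i) y⟩).2) p this (contMDiffAt_proj V)
    refine hsum.congr_of_eventuallyEq ?_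
    have hpre := (FiberBundle.continuous_proj F V).continuousAt (x := p)
    filter_upwards [hpre.eventually hχ, hpre.eventually (t.open_baseSet.mem_nhds
      (FiberBundle.mem_baseSet_trivializationAt F' V' p.1))] with q hq hqt
    have h := key hc he (s q.1 q.2) q.1
    rw [hq, one_mul, one_smul, hs] at h
    have hl : ∀ w : V' q.1, (t ⟨q.1, w⟩).2 = t.linearMapAt ℝ q.1 w := fun w => by
      rw [t.coe_linearMapAt_of_mem (R := ℝ) hqt]
    simp only [LinearMap.coe_mk, AddHom.coe_mk]
    refine (hl _).trans ?_
    rw [h, map_sum]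
    exact Finset.sum_congr rfl fun i _ => by rw [map_smul, hl]

/-- Smooth functions separate tangent vectors. -/
theorem eq_of_dirDeriv_eq {x : M} {v w : TangentSpace I x}
    (h : ∀ f : C^∞⟮I, M; 𝓘(ℝ, ℝ), ℝ⟯, dirDeriv I f x v = dirDeriv I f x w) : v = w := by
  obtain ⟨φ, hφ⟩ := isInvertible_mfderiv_extChartAt (I := I) (mem_extChartAt_source (I := I) x)
  apply φ.injective
  by_contra hne
  -- The chart has invertible derivative at `x`, so `l` composed with the chart and cut off by `χ`
  -- is a global function telling `v` and `w` apart.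
  obtain ⟨l, hl⟩ := SeparatingDual.exists_separating_of_ne (R := ℝ) (V := EM) hne
  obtain ⟨χ, -⟩ := (SmoothBumpFunction.nhds_basis_tsupport (I := I) x).ex_mem
  have hg : ContMDiffOn I 𝓘(ℝ, ℝ) ∞ (fun y => l (extChartAt I x y)) (chartAt H x).source :=
    l.contMDiff.comp_contMDiffOn (contMDiffOn_extChartAt (I := I))
  have hd : MDifferentiableAt I 𝓘(ℝ, EM) (extChartAt I x) x :=
    mdifferentiableAt_extChartAt (ChartedSpace.mem_chart_source x)
  have hm : mfderiv I 𝓘(ℝ, ℝ) (fun y => χ y • l (extChartAt I x y)) x =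
      l.comp (mfderiv I 𝓘(ℝ, EM) (extChartAt I x) x) := by
    have h1 : (fun y => χ y • l (extChartAt I x y)) =ᶠ[𝓝 x] l ∘ extChartAt I x := by
      filter_upwards [χ.eventuallyEq_one] with y hy
      simp [hy]
    rw [h1.mfderiv_eq, mfderiv_comp x l.mdifferentiableAt hd, l.mfderiv_eq]
    rfl
  have := h ⟨_, χ.contMDiff_smul hg⟩
  refine hl ?_
  change mfderiv I 𝓘(ℝ, ℝ) (fun y => χ y • l (extChartAt I x y)) x v =
    mfderiv I 𝓘(ℝ, ℝ) (fun y => χ y • l (extChartAt I x y)) x w at this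
  rw [hm, ← hφ] at this
  exact this

end Tensorial

/-! ### Representations and their differentials -/

section Bialgebroid

variable {EM : Type*} [NormedAddCommGroup EM] [NormedSpace ℝ EM]
  {H : Type*} [TopologicalSpace H] {I : ModelWithCorners ℝ EM H}
  {M : Type*} [TopologicalSpace M] [ChartedSpace H M] [IsManifold I ∞ M]
  {FA : Type*} [NormedAddCommGroup FA] [NormedSpace ℝ FA]
  {A : M → Type*} [TopologicalSpace (TotalSpace FA A)]
  [∀ x, AddCommGroup (A x)] [∀ x, Module ℝ (A x)] [∀ x, TopologicalSpace (A x)]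
  [FiberBundle FA A] [VectorBundle ℝ FA A]
  {FB : Type*} [NormedAddCommGroup FB] [NormedSpace ℝ FB]
  {B : M → Type*} [TopologicalSpace (TotalSpace FB B)]
  [∀ x, AddCommGroup (B x)] [∀ x, Module ℝ (B x)] [∀ x, TopologicalSpace (B x)]
  [FiberBundle FB B] [VectorBundle ℝ FB B]
  {FE : Type*} [NormedAddCommGroup FE] [NormedSpace ℝ FE]
  {E : M → Type*} [TopologicalSpace (TotalSpace FE E)]
  [∀ x, AddCommGroup (E x)] [∀ x, Module ℝ (E x)] [∀ x, TopologicalSpace (E x)]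
  [FiberBundle FE E] [VectorBundle ℝ FE E]

namespace Representation

variable {L : LieAlgebroid I FA A} (ρ : Representation FE E L)

theorem act_add (X : Sec I FA A) (u v : Sec I FE E) : ρ.act X (u + v) = ρ.act X u + ρ.act X v := by
  ext x
  exact map_add (ρ.toFun x (X x)).1.1 u v

theorem act_smul (X : Sec I FA A) (r : ℝ) (u : Sec I FE E) : ρ.act X (r • u) = r • ρ.act X u := by
  ext x
  exact map_smul (ρ.toFun x (X x)).1.1 r u

theorem add_act (X Y : Sec I FA A) (u : Sec I FE E) : ρ.act (X + Y) u = ρ.act X u + ρ.act Y u := by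
  ext x
  exact map_add (gaugeApply u ∘ₗ ρ.toFun x) (X x) (Y x)

theorem smul_act (r : ℝ) (X : Sec I FA A) (u : Sec I FE E) : ρ.act (r • X) u = r • ρ.act X u := by
  ext x
  exact map_smul (gaugeApply u ∘ₗ ρ.toFun x) r (X x)

theorem neg_act (X : Sec I FA A) (u : Sec I FE E) : ρ.act (-X) u = -ρ.act X u := by
  ext x
  exact map_neg (gaugeApply u ∘ₗ ρ.toFun x) (X x)

theorem bracket_act (X Y : Sec I FA A) (u : Sec I FE E) :
    ρ.act (L.bracket X Y) u = ρ.act X (ρ.act Y u) - ρ.act Y (ρ.act X u) := by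
  ext x
  exact ρ.toFun_bracket X Y u x

theorem act_mulSec (X : Sec I FA A) (f : C^∞⟮I, M; 𝓘(ℝ, ℝ), ℝ⟯) (u : Sec I FE E) (x : M) :
    ρ.act X (mulSec f u) x =
      f x • ρ.act X u x + dirDeriv I f x (L.anchor.toFun x (X x)) • u x := by
  rw [← ρ.symbol_toFun]
  exact (ρ.toFun x (X x)).2 f u

end Representation

/-- Global sections of `A` fill each fibre, so nondegeneracy applies pointwise. This gives
uniqueness of `d` and `lieDeriv`, which are known only through their pairings. -/
theorem EPairing.sec_ext [FiniteDimensional ℝ EM] [T2Space M] [ContMDiffVectorBundle ∞ FA A I]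
    (P : EPairing I FA A FB B FE E) {ξ ζ : Sec I FB B} (h : ∀ X, P.pair X ξ = P.pair X ζ) :
    ξ = ζ := by
  ext x
  refine sub_eq_zero.mp (P.nondeg_right x _ fun a => ?_)
  obtain ⟨X, rfl⟩ := exists_sec_eq (I := I) (F := FA) a
  rw [map_sub, sub_eq_zero]
  exact congrArg (fun s : Sec I FE E => s x) (h X)

section d

variable [FiniteDimensional ℝ EM] [T2Space M] [ContMDiffVectorBundle ∞ FA A I]
  {L : LieAlgebroid I FA A} {ρ : Representation FE E L} {P : EPairing I FA A FB B FE E}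

theorem d_add (h : ρ.IsInvariant P) (u v : Sec I FE E) : d h (u + v) = d h u + d h v := by
  refine P.sec_ext fun X => ?_
  rw [pair_d, ρ.act_add, ← pair_d h, ← pair_d h]
  ext x
  exact (map_add (P.toFun x (X x)) _ _).symm

theorem d_smul (h : ρ.IsInvariant P) (r : ℝ) (u : Sec I FE E) : d h (r • u) = r • d h u := by
  refine P.sec_ext fun X => ?_
  rw [pair_d, ρ.act_smul, ← pair_d h]
  ext x
  exact (map_smul (P.toFun x (X x)) _ _).symm

/-- Paired with `Y`, this is `ρ(X)ρ(Y)u - ρ([X, Y])u = ρ(Y)ρ(X)u`, i.e. compatibility of `ρ` with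
brackets. -/
theorem lieDeriv_d (h : ρ.IsInvariant P) (X : Sec I FA A) (u : Sec I FE E) :
    lieDeriv h X (d h u) = d h (ρ.act X u) := by
  refine P.sec_ext fun Y => ?_
  rw [pair_lieDeriv, pair_d, pair_d, pair_d, ρ.bracket_act, sub_sub_cancel]

end d

/-! ### The bracket on `Γ(E)`: skew symmetry, Leibniz rule, locality -/

namespace ELieBialgebroid

variable (D : ELieBialgebroid I FA A FB B FE E)

theorem bracketE_eq_actB (u v : Sec I FE E) : D.bracketE u v = D.repB.act (d D.invA u) v :=
  pair_d D.invB v (d D.invA u)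

theorem bracketE_eq_actA (u v : Sec I FE E) : D.bracketE u v = D.repA.act (d D.invB v) u :=
  pair_d D.invA u (d D.invB v)

theorem bracketE_self (u : Sec I FE E) : D.bracketE u u = 0 := D.compat_pair u

theorem bracketE_mulSec (u v : Sec I FE E) (f : C^∞⟮I, M; 𝓘(ℝ, ℝ), ℝ⟯) (x : M) :
    D.bracketE u (mulSec f v) x = f x • D.bracketE u v x +
      dirDeriv I f x (D.algB.anchor.toFun x (d D.invA u x)) • v x := by
  rw [bracketE_eq_actB, bracketE_eq_actB, D.repB.act_mulSec]

section Hausdorff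

variable [FiniteDimensional ℝ EM] [T2Space M] [ContMDiffVectorBundle ∞ FA A I]

/-- The bracket `[·, ·]_E` as a bilinear map. -/
def bracketLin : Sec I FE E →ₗ[ℝ] Sec I FE E →ₗ[ℝ] Sec I FE E :=
  LinearMap.mk₂ ℝ D.bracketE
    (fun u v w => by simp only [bracketE_eq_actB, d_add, Representation.add_act])
    (fun r u v => by simp only [bracketE_eq_actB, d_smul, Representation.smul_act])
    (fun u v w => by simp only [bracketE_eq_actB, Representation.act_add])
    (fun r u v => by simp only [bracketE_eq_actB, Representation.act_smul])

@[simp]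
theorem bracketLin_apply (u v : Sec I FE E) : D.bracketLin u v = D.bracketE u v := rfl

theorem bracketE_skew (u v : Sec I FE E) : D.bracketE u v = -D.bracketE v u := by
  have h := D.bracketE_self (u + v)
  simp only [← bracketLin_apply, map_add, LinearMap.add_apply] at h
  simp only [bracketLin_apply, bracketE_self, zero_add, add_zero] at h
  exact eq_neg_of_add_eq_zero_right h

theorem mulSec_bracketE (u v : Sec I FE E) (f : C^∞⟮I, M; 𝓘(ℝ, ℝ), ℝ⟯) (x : M) :
    D.bracketE (mulSec f u) v x = f x • D.bracketE u v x -
      dirDeriv I f x (D.algB.anchor.toFun x (d D.invA v x)) • u x := by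
  have h1 : D.bracketE (mulSec f u) v x = -D.bracketE v (mulSec f u) x := by
    rw [D.bracketE_skew]; rfl
  have h2 : D.bracketE u v x = -D.bracketE v u x := by
    rw [D.bracketE_skew]; rfl
  rw [h1, h2, bracketE_mulSec, smul_neg]
  abel

/-- The support of `[u, v]_E` is contained in that of `v`. -/
theorem bracketE_eq_zero_right (u v : Sec I FE E) {x : M} (hx : x ∉ closure {x | v x ≠ 0}) :
    D.bracketE u v x = 0 := by
  obtain ⟨χ, hχ, hs⟩ := exists_bump (I := I) (isClosed_closure.isOpen_compl.mem_nhds hx)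
  have h0 : mulSec χ v = 0 := by
    ext y
    by_cases hy : y ∈ tsupport χ
    · have : v y = 0 := by
        by_contra h
        exact hs hy (subset_closure h)
      simp [this]
    · simp [image_eq_zero_of_notMem_tsupport hy]
  have hv : v x = 0 := by
    by_contra h
    exact hx (subset_closure h)
  -- The left side is zero since `χ v = 0`; on the right the derivative term dies because `v x = 0`,
  -- leaving `[u, v]_E` at `x`.
  have h := D.bracketE_mulSec u v χ x
  rw [h0, hv, hχ.self_of_nhds, smul_zero, add_zero, one_smul, ← bracketLin_apply, map_zero] at h
  exact h.symm

theorem support_bracketE_subset (u v : Sec I FE E) :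
    closure {x | D.bracketE u v x ≠ 0} ⊆ closure {x | u x ≠ 0} ∩ closure {x | v x ≠ 0} := by
  refine closure_minimal (fun x hx => ⟨?_, ?_⟩) (isClosed_closure.inter isClosed_closure)
  · by_contra h
    refine hx ?_
    rw [D.bracketE_skew, ContMDiffSection.coe_neg, Pi.neg_apply,
      D.bracketE_eq_zero_right v u h, neg_zero]
  · by_contra h
    exact hx (D.bracketE_eq_zero_right u v h)

end Hausdorff

/-! ### The Jacobi identity -/

section Jacobi

variable [FiniteDimensional ℝ EM] [T2Space M] [ContMDiffVectorBundle ∞ FA A I]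
  [ContMDiffVectorBundle ∞ FB B I]

/-- Condition 2 at `X = d^B v`, whose left side is `d^B (ρ_B(d^A u) v)` by `lieDeriv_d`. -/
theorem d_bracketE (u v : Sec I FE E) :
    d D.invB (D.bracketE u v) = -D.algA.bracket (d D.invB u) (d D.invB v) := by
  rw [← D.compat_lieDeriv, lieDeriv_d, bracketE_eq_actB]

theorem bracketE_jacobi (u v w : Sec I FE E) :
    D.bracketE u (D.bracketE v w) =
      D.bracketE (D.bracketE u v) w + D.bracketE v (D.bracketE u w) := by
  have hn : ∀ a b, D.bracketE a (-b) = -D.bracketE a b := fun a b => map_neg (D.bracketLin a) b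
  -- Here `[[u, v], w] = -ρ_A(d^B [u, v]) w = ρ_A([d^B u, d^B v]) w`, a commutator; reading each
  -- `ρ_A(d^B ·)` as a bracket leaves only sign changes.
  have h : D.bracketE (D.bracketE u v) w =
      D.repA.act (d D.invB u) (D.repA.act (d D.invB v) w) -
        D.repA.act (d D.invB v) (D.repA.act (d D.invB u) w) := by
    rw [D.bracketE_skew, bracketE_eq_actA, d_bracketE, Representation.neg_act, neg_neg,
      Representation.bracket_act]
  simp only [← bracketE_eq_actA] at h
  rw [h, D.bracketE_skew (D.bracketE w v), D.bracketE_skew (D.bracketE w u),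
    D.bracketE_skew w v, D.bracketE_skew w u, hn, hn]
  abel

/-- The local Lie algebra of an `E`-Lie bialgebroid. -/
def localLieAlgebra : LocalLieAlgebra I FE E where
  bracket := D.bracketLin
  bracket_self := D.bracketE_self
  jacobi := D.bracketE_jacobi
  support_subset := D.support_bracketE_subset

end Jacobi

/-! ### The anchor in rank at least two -/

section Anchor

/-- The vector field `b(d^A u)`, where `b` is the anchor of `B`. -/
def anchorField (u : Sec I FE E) : Sec I EM (TangentSpace I : M → Type _) :=
  ⟨fun x => D.algB.anchor.toFun x (d D.invA u x),
    D.algB.anchor.contMDiff_toFun.comp (d D.invA u).contMDiff⟩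

variable [FiniteDimensional ℝ EM] [T2Space M] [ContMDiffVectorBundle ∞ FA A I]

theorem anchorField_add (u v : Sec I FE E) :
    D.anchorField (u + v) = D.anchorField u + D.anchorField v := by
  ext x
  simp only [anchorField, d_add]
  exact map_add (D.algB.anchor.toFun x) _ _

theorem anchorField_smul (r : ℝ) (u : Sec I FE E) :
    D.anchorField (r • u) = r • D.anchorField u := by
  ext x
  simp only [anchorField, d_smul]
  exact map_smul (D.algB.anchor.toFun x) _ _

variable [ContMDiffVectorBundle ∞ FE E I]

/-- Rank at least two provides `v` with `u x`, `v x` independent, so coefficients can be compared in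
the two Leibniz expansions of `[g u, f v]_E`. -/
theorem anchorField_mulSec_of_ne_zero (hE : 2 ≤ Module.finrank ℝ FE)
    (g : C^∞⟮I, M; 𝓘(ℝ, ℝ), ℝ⟯) {u : Sec I FE E} {x : M} (hu : u x ≠ 0) :
    D.anchorField (mulSec g u) x = g x • D.anchorField u x := by
  have hr : 1 < Module.finrank ℝ (E x) := by
    rwa [(VectorBundle.continuousLinearEquivAt ℝ FE E x).toLinearEquiv.finrank_eq]
  obtain ⟨a, ha⟩ := exists_linearIndependent_pair_of_one_lt_finrank hr hu
  obtain ⟨v, rfl⟩ := exists_sec_eq (I := I) (F := FE) a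
  refine eq_of_dirDeriv_eq fun f => ?_
  have h1 := D.bracketE_mulSec (mulSec g u) v f x
  rw [mulSec_bracketE, mulSec_bracketE, bracketE_mulSec] at h1
  change _ = _ + dirDeriv I f x (D.anchorField (mulSec g u) x) • v x at h1
  rw [dirDeriv_smul]
  have h2 := LinearIndependent.pair_iff.1 ha
    (f x * dirDeriv I g x (D.anchorField v x) - dirDeriv I g x (D.anchorField (mulSec f v) x))
    (g x * dirDeriv I f x (D.anchorField u x) - dirDeriv I f x (D.anchorField (mulSec g u) x)) ?_
  · exact (sub_eq_zero.1 h2.2).symm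
  · simp only [anchorField, ContMDiffSection.coeFn_mk] at h1 ⊢
    rw [← sub_eq_zero] at h1
    rw [← h1]
    module

theorem anchorField_mulSec (hE : 2 ≤ Module.finrank ℝ FE)
    (g : C^∞⟮I, M; 𝓘(ℝ, ℝ), ℝ⟯) (u : Sec I FE E) :
    D.anchorField (mulSec g u) = mulSec g (D.anchorField u) := by
  ext x
  by_cases hu : u x = 0
  · have : Nontrivial FE := Module.nontrivial_of_finrank_pos (R := ℝ) (by omega)
    -- Where `u` vanishes, write `u = (u + w) - w` with both terms nonzero at `x` and use
    -- additivity.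
    obtain ⟨w, hw0⟩ := exists_sec_ne_zero (I := I) (F := FE) (V := E) x
    have h1 := D.anchorField_mulSec_of_ne_zero hE g hw0
    have h2 := D.anchorField_mulSec_of_ne_zero hE g (u := u + w) (x := x) (by simpa [hu])
    have h3 : mulSec g (u + w) = mulSec g u + mulSec g w := by
      ext y
      exact smul_add _ _ _
    rw [h3, anchorField_add, anchorField_add] at h2
    simp only [ContMDiffSection.coe_add, Pi.add_apply, h1, smul_add] at h2
    exact add_right_cancel h2
  · exact D.anchorField_mulSec_of_ne_zero hE g hu

/-- An operator on a nonzero bundle determines its symbol, so equality of the actions in `hact`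
reduces the claim to the anchor of `B`. -/
theorem dirDeriv_anchorField_bracketE [ContMDiffVectorBundle ∞ FB B I] [Nontrivial FE]
    (u v : Sec I FE E) (f : C^∞⟮I, M; 𝓘(ℝ, ℝ), ℝ⟯) (x : M) :
    dirDeriv I f x (D.anchorField (D.bracketE u v) x) =
      dirDeriv I (fun y => dirDeriv I f y (D.anchorField v y)) x (D.anchorField u x) -
      dirDeriv I (fun y => dirDeriv I f y (D.anchorField u y)) x (D.anchorField v x) := by
  have hact : ∀ w, D.repB.act (d D.invA (D.bracketE u v)) w =
      D.repB.act (D.algB.bracket (d D.invA u) (d D.invA v)) w := by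
    intro w
    rw [D.repB.bracket_act]
    simp only [← bracketE_eq_actB]
    rw [D.bracketE_jacobi u v w, add_sub_cancel_right]
  obtain ⟨w, hw0⟩ := exists_sec_ne_zero (I := I) (F := FE) (V := E) x
  -- On `f w` the two actions can differ only in their symbol terms, which are multiples of `w x ≠
  -- 0`.
  have h := congrArg (fun s : Sec I FE E => s x) (hact (mulSec f w))
  simp only [D.repB.act_mulSec, hact w] at h
  exact (smul_left_injective ℝ hw0 (add_left_cancel h)).trans (D.algB.anchor_bracket _ _ f x)

/-- If the rank of `E` is at least `2`, then `E` is a Lie algebroid. -/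
theorem exists_lieAlgebroid [FiniteDimensional ℝ FE] [ContMDiffVectorBundle ∞ FB B I]
    (hE : 2 ≤ Module.finrank ℝ FE) :
    ∃ L : LieAlgebroid I FE E, (∀ u v, L.bracket u v = D.bracketE u v) ∧
      ∀ (u : Sec I FE E) x, L.anchor.toFun x (u x) = D.anchorField u x := by
  have : Nontrivial FE := Module.nontrivial_of_finrank_pos (R := ℝ) (by omega)
  obtain ⟨φ, hφ⟩ := exists_bundleMap (I := I)
    { toFun := D.anchorField, map_add' := D.anchorField_add, map_smul' := D.anchorField_smul }
    (D.anchorField_mulSec hE)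
  replace hφ : ∀ (u : Sec I FE E) x, φ.toFun x (u x) = D.anchorField u x := hφ
  refine ⟨⟨D.bracketLin, D.bracketE_self, D.bracketE_jacobi, φ, fun u v f x => ?_,
    fun u v f x => ?_⟩, fun _ _ => rfl, hφ⟩
  · rw [hφ]
    exact D.bracketE_mulSec u v f x
  · simp only [hφ]
    exact D.dirDeriv_anchorField_bracketE u v f x

end Anchor

end ELieBialgebroid

end Bialgebroid

end

end ELie

theorem mainTheorem3
    {EM : Type*} [NormedAddCommGroup EM] [NormedSpace ℝ EM] [FiniteDimensional ℝ EM]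
    {H : Type*} [TopologicalSpace H] (I : ModelWithCorners ℝ EM H) [I.Boundaryless]
    {M : Type*} [TopologicalSpace M] [T2Space M] [SigmaCompactSpace M]
    [ChartedSpace H M] [IsManifold I ∞ M]
    {FA : Type*} [NormedAddCommGroup FA] [NormedSpace ℝ FA] [FiniteDimensional ℝ FA]
    {A : M → Type*} [TopologicalSpace (TotalSpace FA A)]
    [∀ x, AddCommGroup (A x)] [∀ x, Module ℝ (A x)] [∀ x, TopologicalSpace (A x)]
    [FiberBundle FA A] [VectorBundle ℝ FA A] [ContMDiffVectorBundle ∞ FA A I]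
    {FB : Type*} [NormedAddCommGroup FB] [NormedSpace ℝ FB] [FiniteDimensional ℝ FB]
    {B : M → Type*} [TopologicalSpace (TotalSpace FB B)]
    [∀ x, AddCommGroup (B x)] [∀ x, Module ℝ (B x)] [∀ x, TopologicalSpace (B x)]
    [FiberBundle FB B] [VectorBundle ℝ FB B] [ContMDiffVectorBundle ∞ FB B I]
    {FE : Type*} [NormedAddCommGroup FE] [NormedSpace ℝ FE] [FiniteDimensional ℝ FE]
    {E : M → Type*} [TopologicalSpace (TotalSpace FE E)]
    [∀ x, AddCommGroup (E x)] [∀ x, Module ℝ (E x)] [∀ x, TopologicalSpace (E x)]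
    [FiberBundle FE E] [VectorBundle ℝ FE E] [ContMDiffVectorBundle ∞ FE E I]
    (D : ELie.ELieBialgebroid I FA A FB B FE E) :
    (2 ≤ Module.finrank ℝ FE →
      ∃ L : ELie.LieAlgebroid I FE E,
        (∀ u v : ELie.Sec I FE E, L.bracket u v = D.bracketE u v) ∧
        ∀ (u : ELie.Sec I FE E) (x : M), L.anchor.toFun x (u x) =
          ELie.symbol I FE E x
            (D.repB.toFun x (ELie.jetAdjoint D.repA D.pairing x (ELie.jet u x)))) ∧
    (Module.finrank ℝ FE = 1 →
      ∃ L : ELie.LocalLieAlgebra I FE E,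
        ∀ u v : ELie.Sec I FE E, L.bracket u v = D.bracketE u v) := by
  refine ⟨fun hE => ?_, fun _ => ⟨D.localLieAlgebra, fun _ _ => rfl⟩⟩
  obtain ⟨L, hL, ha⟩ := D.exists_lieAlgebroid hE
  refine ⟨L, hL, fun u x => ?_⟩
  rw [ha, D.repB.symbol_toFun, ELie.jetAdjoint_jet D.invA]
  rfl
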